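/- Let $K$ be a field of characteristic $0$ with an automorphism $\sigma$, and let $A\in\mathrm{GL}_n(K)$. A difference ring is a commutative ring with an automorphism, again denoted $\sigma$. For a field $F$ with an automorphism $\tau$ put $C_F=\{a\in F:\tau(a)=a\}$ and $D_F=\{a\in F:\tau^m(a)=a\text{ for some }m\neq 0\}$. A Picard-Vessiot ring for $\sigma(X)=AX$ over $K$ is a nonzero difference ring extension $R$ of $K$ (the automorphism of $R$ extending that of $K$) of the form $R=K[Z,\det(Z)^{-1}]$ with $Z\in\mathrm{GL}_n(R)$, $\sigma(Z)=AZ$, such that the only ideals $I$ of $R$ with $\sigma(I)\subseteq I$ are $0$ and $R$. For such an $R$ there are an integer $\ell\ge 1$ and a prime ideal $P$ of $R$ with $\sigma^\ell(P)=P$ that is maximal among the proper ideals $J$ of $R$ with $\sigma^\ell(J)\subseteq J$, such that the canonical map $R\to\prod_{i=0}^{\ell-1}R/\sigma^i(P)$ is an isomorphism. For such $\ell$ and $P$, let $F$ be the field of fractions of $R/P$ with the automorphism $\tau$ induced by $\sigma^\ell$, so that $C_F$ and $D_F$ are formed with respect to $\tau$. The $m$-invariant of $R$ is $m(R)=\ell\cdot[D_F:D_KC_F]$,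 where $D_KC_F$ is the compositum in $F$ of $C_F$ and the image of $D_K$; it is a natural number, independent of the choice of $\ell$ and $P$. Proposition 4.9. If $C_K=D_K$, then all Picard-Vessiot rings for $\sigma(X)=AX$ over $K$ have the same Krull dimension and the same $m$-invariant. -/

import Mathlib

/-- `C_F`: the subfield of constants of a field `F` with automorphism `σ`. -/
def constantField {F : Type*} [Field F] (σ : F ≃+* F) : Subfield F where
  carrier := {a | σ a = a}
  mul_mem' {a b} ha hb := by
    simp only [Set.mem_ofPred_eq] at ha hb ⊢
    rw [map_mul, ha, hb]
  one_mem' := map_one σ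
  add_mem' {a b} ha hb := by
    simp only [Set.mem_ofPred_eq] at ha hb ⊢
    rw [map_add, ha, hb]
  zero_mem' := map_zero σ
  neg_mem' {a} ha := by
    simp only [Set.mem_ofPred_eq] at ha ⊢
    rw [map_neg, ha]
  inv_mem' a ha := by
    simp only [Set.mem_ofPred_eq] at ha ⊢
    rw [map_inv₀, ha]

theorem pow_mul_apply_of_fixed {F : Type*} [Field F] (σ : F ≃+* F) {m : ℕ} {a : F}
    (ha : (σ ^ m) a = a) (k : ℕ) : (σ ^ (m * k)) a = a := by
  induction k with
  | zero => simp
  | succ k ih => rw [Nat.mul_succ, pow_add, RingAut.mul_apply, ha, ih]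

/-- `D_F`: the subfield of those elements of `F` that are fixed by some nonzero power of `σ`. -/
def periodicField {F : Type*} [Field F] (σ : F ≃+* F) : Subfield F where
  carrier := {a | ∃ m : ℕ, m ≠ 0 ∧ (σ ^ m) a = a}
  mul_mem' := by
    rintro a b ⟨m, hm, ha⟩ ⟨k, hk, hb⟩
    refine ⟨m * k, mul_ne_zero hm hk, ?_⟩
    have hb' := pow_mul_apply_of_fixed σ hb m
    rw [mul_comm] at hb'
    rw [map_mul, pow_mul_apply_of_fixed σ ha k, hb']
  one_mem' := ⟨1, one_ne_zero, map_one _⟩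
  add_mem' := by
    rintro a b ⟨m, hm, ha⟩ ⟨k, hk, hb⟩
    refine ⟨m * k, mul_ne_zero hm hk, ?_⟩
    have hb' := pow_mul_apply_of_fixed σ hb m
    rw [mul_comm] at hb'
    rw [map_add, pow_mul_apply_of_fixed σ ha k, hb']
  zero_mem' := ⟨1, one_ne_zero, map_zero _⟩
  neg_mem' := by
    rintro a ⟨m, hm, ha⟩
    exact ⟨m, hm, by rw [map_neg, ha]⟩
  inv_mem' := by
    rintro a ⟨m, hm, ha⟩
    exact ⟨m, hm, by rw [map_inv₀, ha]⟩

/-- `(R, σ)` is a Picard-Vessiot ring for `σ(X) = AX` over the difference field `(K, σK)`: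
a difference ring extension of `K` generated by the entries of a fundamental solution matrix `Z`
and by `1 / det Z`, without `σ`-invariant ideals other than `0` and `R`. -/
structure IsPicardVessiotRing {K : Type*} [Field K] (σK : K ≃+* K) {n : ℕ}
    (A : Matrix.GeneralLinearGroup (Fin n) K)
    (R : Type*) [CommRing R] [Algebra K R] (σ : R ≃+* R) : Prop where
  nontrivial : Nontrivial R
  map_algebraMap : ∀ a : K, σ (algebraMap K R a) = algebraMap K R (σK a)
  exists_fundamental : ∃ Z : Matrix.GeneralLinearGroup (Fin n) R,
    (Z : Matrix (Fin n) (Fin n) R).map σ =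
      (A : Matrix (Fin n) (Fin n) K).map (algebraMap K R) * (Z : Matrix (Fin n) (Fin n) R) ∧
    Algebra.adjoin K
      (insert ((Z⁻¹ : Matrix.GeneralLinearGroup (Fin n) R).det : R)
        {z : R | ∃ i j, z = (Z : Matrix (Fin n) (Fin n) R) i j}) = ⊤
  simple : ∀ I : Ideal R, (∀ a ∈ I, σ a ∈ I) → I = ⊥ ∨ I = ⊤

/-- `P` is a prime ideal of `R` which is a maximal `σ^ℓ`-ideal (stable under `σ^ℓ`), and the
canonical map `R → R/P × R/σ(P) × ⋯ × R/σ^(ℓ-1)(P)` is an isomorphism. Hence `ℓ` is the number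
of primitive idempotents of `R`, and `R/P` is one of the domains of which `R` is the direct sum. -/
structure IsPrimeDecomposition {R : Type*} [CommRing R] (σ : R ≃+* R) (ℓ : ℕ) (P : Ideal R) :
    Prop where
  pos : 0 < ℓ
  isPrime : P.IsPrime
  stable : P = P.map ((σ ^ ℓ : R ≃+* R) : R →+* R)
  maximal : ∀ J : Ideal R, (∀ a ∈ J, (σ ^ ℓ) a ∈ J) → P ≤ J → J = P ∨ J = ⊤
  bijective : Function.Bijective
    (RingHom.pi fun i : Fin ℓ =>
      Ideal.Quotient.mk (P.map ((σ ^ (i : ℕ) : R ≃+* R) : R →+* R)))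

/-- The automorphism of the field of fractions of `R/P` induced by an automorphism `τ` of `R`
with `τ(P) = P`. -/
noncomputable def inducedAut {R : Type*} [CommRing R] (P : Ideal R) [P.IsPrime] (τ : R ≃+* R)
    (h : P = P.map (τ : R →+* R)) : FractionRing (R ⧸ P) ≃+* FractionRing (R ⧸ P) :=
  IsFractionRing.ringEquivOfRingEquiv (Ideal.quotientEquiv P P τ h)

/-- The degree `[D_F : D_K C_F]`, where `F` is a field extension of `K` and `τ` an automorphism
of `F`; here `D_K C_F` is the compositum, inside `F`, of (the image of) `D_K` and `C_F`. -/
noncomputable def periodicDegree {K : Type*} [Field K] (σK : K ≃+* K)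
    (F : Type*) [Field F] [Algebra K F] (τ : F ≃+* F) : Cardinal :=
  Subfield.relrank ((periodicField σK).map (algebraMap K F) ⊔ constantField τ) (periodicField τ)

/-- The `m`-invariant of `R` is (well defined and equal to) the natural number `m`: there is a
decomposition of `R` into domains as in `IsPrimeDecomposition`, and for each of them, with
`F = Frac(R/P)` regarded as a difference field by means of `σ^ℓ`, one has
`m = ℓ · [D_F : D_K C_F]`. -/
def HasMInvariant {K : Type*} [Field K] (σK : K ≃+* K)
    (R : Type*) [CommRing R] [Algebra K R] (σ : R ≃+* R) (m : ℕ) : Prop :=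
  (∃ (ℓ : ℕ) (P : Ideal R), IsPrimeDecomposition σ ℓ P) ∧
  ∀ (ℓ : ℕ) (P : Ideal R) (h : IsPrimeDecomposition σ ℓ P),
    haveI : P.IsPrime := h.isPrime
    (ℓ : Cardinal) *
      periodicDegree σK (FractionRing (R ⧸ P)) (inducedAut P (σ ^ ℓ) h.stable) = m

/-! For a simple difference ring `R`, finitely generated over `K`, let `C_R` be its ring of
constants, which is a field, and `D_R` the `C_R`-module of its periodic elements. If `C_K = D_K`,
then `m(R)` is the rank of `D_R` over `C_R`. Indeed `D_K` maps into `C_F`, so the compositum in the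
definition is just `C_F`; periodic elements of the fraction field of a simple domain already lie in
the domain; and the decomposition of `R` into `ℓ` copies of `R/P` multiplies the rank by `ℓ`
(`IsPrimeDecomposition.rank_periodicSubmodule`).

Two Picard-Vessiot rings `R₁`, `R₂` are compared through a simple quotient `S` of `R₁ ⊗ R₂`. The
quotient of the two fundamental matrices has constant entries in `S`, so `S` is spanned by constants
over each `Rᵢ` (`IsPicardVessiotRing.span_fixed_eq_top`). Constants that are independent over
`C_{Rᵢ}` remain independent over `Rᵢ`, so in effect `S = Rᵢ ⊗ C_S` over `C_{Rᵢ}`. Hence `D_S =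
D_{Rᵢ} ⊗ C_S`, and the rank of periodic elements is the same for `S` and `Rᵢ`.

For the dimension, Chevalley's theorem shows that the constants of `S` are algebraic over `K`. Thus
`S` is integral over each `Rᵢ`, which embeds in `S` by simplicity, and all three rings have the same
Krull dimension. -/

/-! ### Constants and periodic elements -/

/-- The subring of constants of a difference ring. -/
def fixedSubring {R : Type*} [CommRing R] (σ : R ≃+* R) : Subring R where
  carrier := {a | σ a = a}
  mul_mem' {a b} ha hb := by
    simp only [Set.mem_ofPred_eq] at ha hb ⊢
    rw [map_mul, ha, hb]
  one_mem' := map_one σ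
  add_mem' {a b} ha hb := by
    simp only [Set.mem_ofPred_eq] at ha hb ⊢
    rw [map_add, ha, hb]
  zero_mem' := map_zero σ
  neg_mem' {a} ha := by
    simp only [Set.mem_ofPred_eq] at ha ⊢
    rw [map_neg, ha]

theorem mem_fixedSubring {R : Type*} [CommRing R] {σ : R ≃+* R} {a : R} :
    a ∈ fixedSubring σ ↔ σ a = a := Iff.rfl

theorem pow_apply_of_fixed {R : Type*} [CommRing R] {σ : R ≃+* R} {a : R}
    (ha : σ a = a) (k : ℕ) : (σ ^ k) a = a := by
  induction k with
  | zero => simp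
  | succ k ih => rw [pow_succ, RingAut.mul_apply, ha, ih]

theorem pow_apply_of_dvd {R : Type*} [CommRing R] {σ : R ≃+* R} {a : R} {m k : ℕ}
    (ha : (σ ^ m) a = a) (h : m ∣ k) : (σ ^ k) a = a := by
  obtain ⟨l, rfl⟩ := h
  rw [pow_mul]
  exact pow_apply_of_fixed ha l

/-- The module, over the constants, of the elements of a difference ring that are fixed by some
nonzero power of the automorphism. -/
def periodicSubmodule {R : Type*} [CommRing R] (σ : R ≃+* R) :
    Submodule (fixedSubring σ) R where
  carrier := {a | ∃ m : ℕ, m ≠ 0 ∧ (σ ^ m) a = a}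
  add_mem' := by
    rintro a b ⟨m, hm, ha⟩ ⟨k, hk, hb⟩
    refine ⟨m * k, mul_ne_zero hm hk, ?_⟩
    rw [map_add, pow_apply_of_dvd ha (dvd_mul_right m k), pow_apply_of_dvd hb (dvd_mul_left k m)]
  zero_mem' := ⟨1, one_ne_zero, map_zero _⟩
  smul_mem' := by
    rintro ⟨c, hc⟩ a ⟨m, hm, ha⟩
    refine ⟨m, hm, ?_⟩
    change (σ ^ m) (c * a) = c * a
    rw [map_mul, ha, pow_apply_of_fixed hc]

/-- Finitely many periodic elements have a common period. -/
theorem exists_common_period {R : Type*} [CommRing R] {σ : R ≃+* R} {ι : Type*} [Finite ι]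
    {a : ι → R} (ha : ∀ i, a i ∈ periodicSubmodule σ) :
    ∃ m : ℕ, m ≠ 0 ∧ ∀ i, (σ ^ m) (a i) = a i := by
  have := Fintype.ofFinite ι
  choose m hm h using ha
  exact ⟨∏ i, m i, Finset.prod_ne_zero_iff.2 fun i _ => hm i,
    fun i => pow_apply_of_dvd (h i) (Finset.dvd_prod_of_mem m (Finset.mem_univ i))⟩

theorem pow_algebraMap_comm {R S : Type*} [CommRing R] [CommRing S] [Algebra R S]
    {σ : R ≃+* R} {τ : S ≃+* S} (h : ∀ r, τ (algebraMap R S r) = algebraMap R S (σ r)) (k : ℕ)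
    (r : R) : (τ ^ k) (algebraMap R S r) = algebraMap R S ((σ ^ k) r) := by
  induction k generalizing r with
  | zero => simp
  | succ k ih => rw [pow_succ, RingAut.mul_apply, h, ih, pow_succ, RingAut.mul_apply]

/-! ### Simple difference rings and their constants -/

/-- A difference ring is simple if it is nonzero and has no nontrivial difference ideals. -/
structure IsDifferenceSimple {R : Type*} [CommRing R] (σ : R ≃+* R) : Prop where
  nontrivial : Nontrivial R
  eq_bot_or_eq_top : ∀ I : Ideal R, (∀ a ∈ I, σ a ∈ I) → I = ⊥ ∨ I = ⊤

theorem IsDifferenceSimple.of_field {K : Type*} [Field K] (σ : K ≃+* K) :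
    IsDifferenceSimple σ :=
  ⟨inferInstance, fun I _ => Ideal.eq_bot_or_top I⟩

theorem IsDifferenceSimple.eq_top {R : Type*} [CommRing R] {σ : R ≃+* R}
    (hσ : IsDifferenceSimple σ) {I : Ideal R} (hI : ∀ a ∈ I, σ a ∈ I) {a : R} (ha : a ∈ I)
    (ha0 : a ≠ 0) : I = ⊤ := by
  refine (hσ.eq_bot_or_eq_top I hI).resolve_left ?_
  rintro rfl
  exact ha0 ha

/-- The principal ideal generated by a constant is a difference ideal. -/
theorem IsDifferenceSimple.isUnit_of_fixed {R : Type*} [CommRing R] {σ : R ≃+* R}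
    (hσ : IsDifferenceSimple σ) {a : R} (ha : σ a = a) (ha0 : a ≠ 0) : IsUnit a := by
  rw [← Ideal.span_singleton_eq_top]
  refine hσ.eq_top ?_ (Ideal.mem_span_singleton_self a) ha0
  intro b hb
  rw [Ideal.mem_span_singleton] at hb ⊢
  obtain ⟨c, rfl⟩ := hb
  exact ⟨σ c, by rw [map_mul, ha]⟩

theorem IsDifferenceSimple.isField_fixedSubring {R : Type*} [CommRing R] {σ : R ≃+* R}
    (hσ : IsDifferenceSimple σ) : IsField (fixedSubring σ) where
  exists_pair_ne := by
    have := hσ.nontrivial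
    exact ⟨0, 1, zero_ne_one⟩
  mul_comm := mul_comm
  mul_inv_cancel := by
    rintro ⟨a, ha⟩ ha0
    have ha0' : a ≠ 0 := fun h => ha0 (Subtype.ext h)
    obtain ⟨b, hb⟩ := (hσ.isUnit_of_fixed ha ha0').exists_right_inv
    refine ⟨⟨b, ?_⟩, Subtype.ext hb⟩
    apply (hσ.isUnit_of_fixed ha ha0').mul_left_cancel
    have := congrArg σ hb
    rw [map_mul, map_one, ha] at this
    rw [this, hb]

/-- Constants of an extension of a simple difference ring which are linearly independent over the
constants are linearly independent over the whole ring. -/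
theorem IsDifferenceSimple.linearIndependent_of_fixed {R S : Type*} [CommRing R] [CommRing S]
    [Algebra R S] {σ : R ≃+* R} {τ : S ≃+* S} (hσ : IsDifferenceSimple σ)
    (h : ∀ r, τ (algebraMap R S r) = algebraMap R S (σ r)) {J : Type*} {e : J → S}
    (he : ∀ j, τ (e j) = e j) (hli : LinearIndependent (fixedSubring σ) e) :
    LinearIndependent R e := by
  classical
  have := hσ.nontrivial
  have key : ∀ l : J →₀ R, Finsupp.linearCombination R e l = 0 →
      Finsupp.linearCombination R e (l.mapRange σ (map_zero σ)) = 0 := by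
    intro l hl
    have := congrArg τ hl
    rw [map_zero, Finsupp.linearCombination_apply, map_finsuppSum] at this
    rw [Finsupp.linearCombination_apply, Finsupp.sum_mapRange_index (by simp), ← this]
    refine Finsupp.sum_congr fun j _ => ?_
    rw [Algebra.smul_def, Algebra.smul_def, map_mul, he, h]
  rw [linearIndependent_iff]
  suffices H : ∀ (n : ℕ) (l : J →₀ R), l.support.card ≤ n →
      Finsupp.linearCombination R e l = 0 → l = 0 from fun l hl => H _ l le_rfl hl
  intro n
  induction n with
  | zero =>
    intro l hl _
    simpa using hl
  | succ n ih =>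
    intro l hcard hl
    by_contra hl0
    obtain ⟨j₀, hj₀⟩ := Finsupp.ne_iff.1 hl0
    rw [Finsupp.zero_apply] at hj₀
    -- The values at `j₀` of all relations supported in the support of `l` form a difference ideal,
    -- so some such relation has coefficient `1` there.
    let I : Ideal R :=
      { carrier := {r | ∃ l' : J →₀ R, l'.support ⊆ l.support ∧
          Finsupp.linearCombination R e l' = 0 ∧ l' j₀ = r}
        add_mem' := by
          rintro _ _ ⟨l₁, h₁, h₁', rfl⟩ ⟨l₂, h₂, h₂', rfl⟩
          exact ⟨l₁ + l₂, Finsupp.support_add.trans (Finset.union_subset h₁ h₂),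
            by rw [map_add, h₁', h₂', add_zero], rfl⟩
        zero_mem' := ⟨0, by simp, by simp, rfl⟩
        smul_mem' := by
          rintro c _ ⟨l₁, h₁, h₁', rfl⟩
          exact ⟨c • l₁, Finsupp.support_smul.trans h₁, by rw [map_smul, h₁', smul_zero], rfl⟩ }
    have hI : I = ⊤ := by
      refine hσ.eq_top ?_ (show l j₀ ∈ I from ⟨l, subset_rfl, hl, rfl⟩) hj₀
      rintro _ ⟨l₁, h₁, h₁', rfl⟩
      exact ⟨l₁.mapRange σ (map_zero σ), Finsupp.support_mapRange.trans h₁, key _ h₁', by simp⟩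
    obtain ⟨l', hsupp, hl', hone⟩ := show (1 : R) ∈ I from hI ▸ Submodule.mem_top
    -- Subtracting the normalized relation from its image under `σ` cancels the coefficient at `j₀`.
    -- The shorter relation vanishes by induction, so all coefficients of `l'` are constants.
    have hfix : l'.mapRange σ (map_zero σ) - l' = 0 := by
      apply ih
      · have hsub : (l'.mapRange σ (map_zero σ) - l').support ⊆ l.support.erase j₀ := by
          intro j hj
          rw [Finset.mem_erase]
          refine ⟨?_, ?_⟩
          · rintro rfl
            simp [hone] at hj
          · rcases Finset.mem_union.1 (Finsupp.support_sub hj) with h' | h'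
            · exact hsupp (Finsupp.support_mapRange h')
            · exact hsupp h'
        have := Finset.card_le_card hsub
        rw [Finset.card_erase_of_mem (Finsupp.mem_support_iff.2 hj₀)] at this
        omega
      · rw [map_sub, key _ hl', hl', sub_zero]
    have hfix' : ∀ j, l' j ∈ fixedSubring σ := fun j => by
      have := DFunLike.congr_fun hfix j
      rw [mem_fixedSubring]
      simpa [sub_eq_zero] using this
    let lc : J →₀ fixedSubring σ := Finsupp.onFinset l'.support (fun j => ⟨l' j, hfix' j⟩)
      (fun j hj => Finsupp.mem_support_iff.2 fun h0 => hj (Subtype.ext h0))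
    have hlc : lc = 0 := by
      apply linearIndependent_iff.1 hli
      rw [← hl', Finsupp.linearCombination_apply, Finsupp.linearCombination_apply]
      rw [Finsupp.sum_of_support_subset lc (s := l'.support) Finsupp.support_onFinset_subset _
        (by simp), Finsupp.sum]
      rfl
    have := congrArg Subtype.val (DFunLike.congr_fun hlc j₀)
    have h1 : l' j₀ = 0 := this
    exact one_ne_zero (hone.symm.trans h1)

/-! ### Integral extensions, and algebraicity via Chevalley's theorem -/

/-- Incomparability gives one inequality; lying over for the bottom prime of a chain, followed by
going up, gives the other. -/
theorem ringKrullDim_eq_of_isIntegral_of_injective {R S : Type*} [CommRing R] [CommRing S]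
    [Algebra R S] [Algebra.IsIntegral R S] (hinj : Function.Injective (algebraMap R S)) :
    ringKrullDim S = ringKrullDim R := by
  apply le_antisymm
  · refine Order.krullDim_le_of_strictMono (PrimeSpectrum.comap (algebraMap R S)) ?_
    intro p q hpq
    exact Ideal.IsIntegral.comap_lt_comap (A := S) hpq
  · refine iSup_le fun l => ?_
    obtain ⟨Q, hQ, hQ'⟩ := Ideal.exists_ideal_over_prime_of_isIntegral (S := S)
      l.head.asIdeal ⊥ (by rw [Ideal.comap_bot_of_injective _ hinj]; exact bot_le)
    obtain ⟨hQ₁, hQ₂⟩ := hQ'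
    have : Q.LiesOver l.head.asIdeal := ⟨hQ₂.symm⟩
    obtain ⟨L, hL, -, -⟩ := Ideal.exists_ltSeries_of_hasGoingUp l Q
    rw [← hL]
    exact le_iSup (fun L : LTSeries (PrimeSpectrum S) => ((L.length : ℕ∞) : WithBot ℕ∞)) L

/-- If `c` were transcendental, it would define a dominant map from `Spec S` to the affine line. Its
image is constructible and contains the generic point, hence contains all but finitely many closed
points. But it misses every natural number, and in characteristic `0` there are infinitely many of
these. -/
theorem isAlgebraic_of_forall_isUnit_sub_natCast {K S : Type*} [Field K] [CharZero K] [CommRing S]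
    [Algebra K S] [Nontrivial S] [Algebra.FiniteType K S] {c : S}
    (hc : ∀ k : ℕ, IsUnit (c - k)) : IsAlgebraic K c := by
  by_contra htr
  let f : Polynomial K →ₐ[K] S := Polynomial.aeval c
  have hinj : Function.Injective f := transcendental_iff_injective.1 htr
  have hft : (f : Polynomial K →+* S).FinitePresentation := by
    rw [← RingHom.FinitePresentation.of_finiteType]
    refine RingHom.FiniteType.of_comp_finiteType (f := algebraMap K (Polynomial K)) ?_
    rw [AlgHom.comp_algebraMap]
    exact RingHom.finiteType_algebraMap.2 inferInstance
  have hcons := PrimeSpectrum.isConstructible_range_comap hft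
  obtain ⟨D, hD⟩ := PrimeSpectrum.exists_constructibleSetData_iff.2 hcons
  have hbot : (⊥ : PrimeSpectrum (Polynomial K)) ∈ D.toSet := by
    rw [hD]
    obtain ⟨q, hq, hq'⟩ := Ideal.exists_comap_eq_of_mem_minimalPrimes_of_injective
      (f := (f : Polynomial K →+* S)) hinj ⊥ (by simp [IsDomain.minimalPrimes_eq_singleton_bot])
    exact ⟨⟨q, hq⟩, PrimeSpectrum.ext hq'⟩
  simp only [PrimeSpectrum.ConstructibleSetData.toSet, Set.mem_iUnion] at hbot
  obtain ⟨B, hB, hbotB⟩ := hbot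
  -- The piece `B` contains the generic point, so its closed conditions are vacuous: it is the open
  -- set where `B.f` does not vanish.
  have hg : ∀ i, B.g i = 0 := fun i => by
    simpa using hbotB.1 (Set.mem_range_self i)
  have hf0 : B.f ≠ 0 := fun h => hbotB.2 (by simp [h])
  obtain ⟨k, hk⟩ : ∃ k : ℕ, B.f.eval (k : K) ≠ 0 := by
    by_contra! hall
    refine hf0 (Polynomial.eq_zero_of_infinite_isRoot _ ?_)
    exact (Set.infinite_range_of_injective (Nat.cast_injective (R := K))).mono
      (by rintro _ ⟨k, rfl⟩; exact hall k)
  have hprime : (Ideal.span {Polynomial.X - Polynomial.C (k : K)}).IsPrime := by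
    rw [Ideal.span_singleton_prime (Polynomial.X_sub_C_ne_zero _)]
    exact Polynomial.prime_X_sub_C _
  have hmem : (⟨_, hprime⟩ : PrimeSpectrum (Polynomial K)) ∈ D.toSet := by
    simp only [PrimeSpectrum.ConstructibleSetData.toSet, Set.mem_iUnion]
    refine ⟨B, hB, ?_, ?_⟩
    · rintro _ ⟨i, rfl⟩
      simp [hg]
    · intro h
      apply hk
      have := h rfl
      rwa [SetLike.mem_coe, Ideal.mem_span_singleton, Polynomial.dvd_iff_isRoot] at this
  rw [hD] at hmem
  obtain ⟨q, hq⟩ := hmem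
  have h1 : Polynomial.X - Polynomial.C (k : K) ∈ q.asIdeal.comap (f : Polynomial K →+* S) := by
    rw [← PrimeSpectrum.comap_asIdeal, hq]
    exact Ideal.mem_span_singleton_self _
  refine q.isPrime.ne_top (Ideal.eq_top_of_isUnit_mem _ h1 ?_)
  simpa [f] using hc k

/-! ### Extensions generated by constants -/

theorem Module.Free.of_isField {A : Type*} [CommRing A] (hA : IsField A) (M : Type*)
    [AddCommGroup M] [Module A M] : Module.Free A M := by
  let _ := hA.toField
  exact inferInstance

/-- The constants of an extension of a difference ring, as a module over the constants of the
base. -/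
def fixedSubmodule {R S : Type*} [CommRing R] [CommRing S] [Algebra R S] (σ : R ≃+* R)
    (τ : S ≃+* S) (h : ∀ r, τ (algebraMap R S r) = algebraMap R S (σ r)) :
    Submodule (fixedSubring σ) S where
  carrier := {s | τ s = s}
  add_mem' {a b} ha hb := by
    simp only [Set.mem_ofPred_eq] at ha hb ⊢
    rw [map_add, ha, hb]
  zero_mem' := map_zero τ
  smul_mem' := by
    rintro ⟨c, hc⟩ a ha
    change τ (c • a) = c • a
    rw [Algebra.smul_def, map_mul, h, mem_fixedSubring.1 hc, show τ a = a from ha]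

/-- If an extension of a simple difference ring is generated by constants as a module, then the
rank of the periodic elements over the constants does not change. -/
theorem finrank_periodicSubmodule_eq_of_span_fixed {R S : Type*} [CommRing R] [CommRing S]
    [Algebra R S] {σ : R ≃+* R} {τ : S ≃+* S} (hinj : Function.Injective (algebraMap R S))
    (hσ : IsDifferenceSimple σ) (h : ∀ r, τ (algebraMap R S r) = algebraMap R S (σ r))
    (hspan : Submodule.span R {s : S | τ s = s} = ⊤)
    [Module.Finite (fixedSubring σ) (periodicSubmodule σ)] :
    Module.finrank (fixedSubring τ) (periodicSubmodule τ) =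
      Module.finrank (fixedSubring σ) (periodicSubmodule σ) := by
  have hR := hσ.nontrivial
  have hS : Nontrivial S := hinj.nontrivial
  have hC := hσ.isField_fixedSubring
  have : Nontrivial (fixedSubring σ) := hC.nontrivial
  have := Module.Free.of_isField hC (fixedSubmodule σ τ h)
  have := Module.Free.of_isField hC (periodicSubmodule σ)
  let e := Module.Free.chooseBasis (fixedSubring σ) (fixedSubmodule σ τ h)
  let b := Module.finBasis (fixedSubring σ) (periodicSubmodule σ)
  have he : ∀ k, τ (e k : S) = (e k : S) := fun k => (e k).2
  have hli : LinearIndependent R fun k => (e k : S) :=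
    hσ.linearIndependent_of_fixed h he
      (e.linearIndependent.map' (fixedSubmodule σ τ h).subtype (Submodule.ker_subtype _))
  have hsp : ⊤ ≤ Submodule.span R (Set.range fun k => (e k : S)) := by
    rw [← hspan, Submodule.span_le]
    intro s hs
    have hs' := congrArg (fixedSubmodule σ τ h).subtype (e.linearCombination_repr ⟨s, hs⟩)
    rw [Finsupp.linearCombination_apply, map_finsuppSum] at hs'
    change _ = s at hs'
    rw [← hs']
    refine Submodule.sum_mem _ fun k _ => ?_
    exact Submodule.smul_mem _ ((e.repr ⟨s, hs⟩ k : fixedSubring σ) : R)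
      (Submodule.subset_span ⟨k, rfl⟩)
  -- A basis of the constants of `S` over those of `R` is an `R`-basis of `S`. Since its members are
  -- constants, taking coordinates commutes with the automorphisms.
  let E := Module.Basis.mk hli hsp
  have hE : ∀ k, E k = (e k : S) := fun k => Module.Basis.mk_apply _ _ k
  have hrepr : ∀ (c : fixedSubmodule σ τ h) (k), E.repr (c : S) k = (e.repr c k : R) := by
    intro c k
    have hc := congrArg (fixedSubmodule σ τ h).subtype (e.linearCombination_repr c)
    rw [Finsupp.linearCombination_apply, map_finsuppSum] at hc
    have hc' : Finsupp.linearCombination R E ((e.repr c).mapRange Subtype.val rfl) = (c : S) := by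
      rw [Finsupp.linearCombination_apply, Finsupp.sum_mapRange_index (by simp)]
      refine Eq.trans (Finsupp.sum_congr fun j _ => ?_) hc
      rw [hE]
      rfl
    rw [← hc', E.repr_linearCombination]
    rfl
  have hrepr_pow : ∀ (m : ℕ) (s : S) (k), E.repr ((τ ^ m) s) k = (σ ^ m) (E.repr s k) := by
    intro m s k
    have hs := congrArg (τ ^ m) (E.linearCombination_repr s)
    rw [Finsupp.linearCombination_apply, map_finsuppSum] at hs
    have hs' : Finsupp.linearCombination R E ((E.repr s).mapRange (σ ^ m) (map_zero _)) =
        (τ ^ m) s := by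
      rw [Finsupp.linearCombination_apply, Finsupp.sum_mapRange_index (by simp)]
      refine Eq.trans (Finsupp.sum_congr fun j _ => ?_) hs
      rw [Algebra.smul_def, Algebra.smul_def, map_mul, hE, pow_apply_of_fixed (he j),
        pow_algebraMap_comm h]
    rw [← hs', E.repr_linearCombination]
    rfl
  have hmem : ∀ r ∈ periodicSubmodule σ, algebraMap R S r ∈ periodicSubmodule τ := by
    rintro r ⟨m, hm, hr⟩
    exact ⟨m, hm, by rw [pow_algebraMap_comm h, hr]⟩
  -- The image of a basis of the periodic elements of `R` will be a basis of those of `S`.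
  let B : Fin (Module.finrank (fixedSubring σ) (periodicSubmodule σ)) → periodicSubmodule τ :=
    fun j => ⟨algebraMap R S (b j), hmem _ (b j).2⟩
  have hBli : LinearIndependent (fixedSubring τ) B := by
    rw [Fintype.linearIndependent_iff]
    intro g hg j
    have hg' := congrArg (periodicSubmodule τ).subtype hg
    rw [map_sum, map_zero] at hg'
    have hg'' : ∑ i, (b i : R) • (g i : S) = 0 := by
      rw [← hg']
      refine Finset.sum_congr rfl fun i _ => ?_
      rw [Algebra.smul_def, mul_comm]
      rfl
    let c : Fin _ → fixedSubmodule σ τ h := fun i => ⟨g i, (g i).2⟩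
    -- Comparing the `k`-th coordinates turns the relation over the constants of `S` into one among
    -- the `b i` over the constants of `R`.
    have hc : ∀ k i, e.repr (c i) k = 0 := by
      intro k
      apply Fintype.linearIndependent_iff.1 (b.linearIndependent.map'
        (periodicSubmodule σ).subtype (Submodule.ker_subtype _))
      have := DFunLike.congr_fun (congrArg E.repr hg'') k
      rw [map_sum, map_zero, Finsupp.finsetSum_apply, Finsupp.zero_apply] at this
      rw [← this]
      refine Finset.sum_congr rfl fun i _ => ?_
      rw [map_smul, Finsupp.smul_apply, smul_eq_mul, mul_comm, hrepr (c i) k]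
      rfl
    have : c j = 0 := e.repr.map_eq_zero_iff.1 (Finsupp.ext fun k => hc k j)
    exact Subtype.ext (congrArg Subtype.val this)
  have hBsp : ⊤ ≤ Submodule.span (fixedSubring τ) (Set.range B) := by
    have hbase : ∀ r (hr : r ∈ periodicSubmodule σ), (⟨algebraMap R S r, hmem r hr⟩ :
        periodicSubmodule τ) ∈ Submodule.span (fixedSubring τ) (Set.range B) := by
      intro r hr
      have hr' := congrArg (periodicSubmodule σ).subtype (b.sum_repr ⟨r, hr⟩)
      rw [map_sum] at hr'
      have hmemc : ∀ i, algebraMap R S (b.repr ⟨r, hr⟩ i : R) ∈ fixedSubring τ := fun i => by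
        rw [mem_fixedSubring, h, mem_fixedSubring.1 (b.repr ⟨r, hr⟩ i).2]
      have : (⟨algebraMap R S r, hmem r hr⟩ : periodicSubmodule τ) =
          ∑ i, (⟨_, hmemc i⟩ : fixedSubring τ) • B i := by
        apply (periodicSubmodule τ).injective_subtype
        rw [map_sum]
        have := congrArg (algebraMap R S) hr'
        rw [map_sum] at this
        refine Eq.trans this.symm (Finset.sum_congr rfl fun i _ => ?_)
        exact map_mul (algebraMap R S) _ _
      rw [this]
      exact Submodule.sum_mem _ fun i _ => Submodule.smul_mem _ _ (Submodule.subset_span ⟨i, rfl⟩)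
    rintro ⟨s, m, hm, hs⟩ -
    -- The coordinates of a periodic element are periodic with the same period.
    have hper : ∀ k, E.repr s k ∈ periodicSubmodule σ := fun k =>
      ⟨m, hm, by rw [← hrepr_pow, hs]⟩
    have : (⟨s, m, hm, hs⟩ : periodicSubmodule τ) = ∑ k ∈ (E.repr s).support,
        (⟨(e k : S), he k⟩ : fixedSubring τ) •
          (⟨algebraMap R S (E.repr s k), hmem _ (hper k)⟩ : periodicSubmodule τ) := by
      apply (periodicSubmodule τ).injective_subtype
      rw [map_sum]
      refine Eq.trans (E.linearCombination_repr s).symm (Finset.sum_congr rfl fun k _ => ?_)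
      change E.repr s k • E k = (e k : S) * algebraMap R S (E.repr s k)
      rw [hE, Algebra.smul_def, mul_comm]
    rw [this]
    exact Submodule.sum_mem _ fun k _ => Submodule.smul_mem _ _ (hbase _ (hper k))
  have : Nontrivial (fixedSubring τ) := inferInstance
  rw [Module.finrank_eq_card_basis (Module.Basis.mk hBli hBsp), Fintype.card_fin]

/-! ### Decomposition of a simple difference ring into domains -/

theorem Ideal.mem_map_ringEquiv {R S : Type*} [CommRing R] [CommRing S] (τ : R ≃+* S)
    {J : Ideal R} {x : S} : x ∈ J.map (τ : R →+* S) ↔ τ.symm x ∈ J := by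
  rw [Ideal.map_comap_of_equiv]
  rfl

theorem Ideal.map_pow_map_pow {R : Type*} [CommRing R] (σ : R ≃+* R) (J : Ideal R) (i k : ℕ) :
    (J.map ((σ ^ i : R ≃+* R) : R →+* R)).map ((σ ^ k : R ≃+* R) : R →+* R) =
      J.map ((σ ^ (k + i) : R ≃+* R) : R →+* R) := by
  rw [Ideal.map_map, pow_add]
  rfl

theorem Ideal.map_pow_zero {R : Type*} [CommRing R] (σ : R ≃+* R) (J : Ideal R) :
    J.map ((σ ^ 0 : R ≃+* R) : R →+* R) = J :=
  Ideal.map_id J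

/-- In a simple difference ring, the translates of a proper ideal that is stable under a power of
the automorphism intersect trivially. -/
theorem IsDifferenceSimple.iInf_map_pow_eq_bot {R : Type*} [CommRing R] {σ : R ≃+* R}
    (hσ : IsDifferenceSimple σ) {ℓ : ℕ} (hℓ : 0 < ℓ) {J : Ideal R}
    (hJ : ∀ a ∈ J, (σ ^ ℓ) a ∈ J) (hJt : J ≠ ⊤) :
    ⨅ i : Fin ℓ, J.map ((σ ^ (i : ℕ) : R ≃+* R) : R →+* R) = ⊥ := by
  refine (hσ.eq_bot_or_eq_top _ ?_).resolve_right ?_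
  · intro a ha
    simp only [Ideal.mem_iInf, Ideal.mem_map_ringEquiv] at ha ⊢
    rintro ⟨i, hi⟩
    rcases i with _ | i
    -- The automorphism carries the last translate back to `J`; this is where stability under `σ ^
    -- ℓ` enters.
    · have h1 := hJ _ (ha ⟨ℓ - 1, by omega⟩)
      have h2 : σ ^ ℓ = σ * σ ^ (ℓ - 1) := by rw [← pow_succ', Nat.sub_add_cancel hℓ]
      rw [h2, RingAut.mul_apply, RingEquiv.apply_symm_apply] at h1
      exact h1
    · have h1 := ha ⟨i, by omega⟩
      have h2 : (σ ^ (i + 1)).symm (σ a) = (σ ^ i).symm a := by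
        rw [RingEquiv.symm_apply_eq, pow_succ', RingAut.mul_apply, RingEquiv.apply_symm_apply]
      rw [h2]
      exact h1
  · intro htop
    apply hJt
    rw [eq_top_iff, ← htop]
    refine (iInf_le (fun i : Fin ℓ => J.map ((σ ^ (i : ℕ) : R ≃+* R) : R →+* R)) ⟨0, hℓ⟩).trans ?_
    rw [Ideal.map_pow_zero]

/-- If `d` is a nonzero element of a proper ideal stable under `σ ^ m`, the product of its first `m`
translates lies in every translate of the ideal. These intersect in zero, which is impossible in a
domain. -/
theorem IsDifferenceSimple.pow {R : Type*} [CommRing R] [IsDomain R] {σ : R ≃+* R}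
    (hσ : IsDifferenceSimple σ) {m : ℕ} (hm : m ≠ 0) : IsDifferenceSimple (σ ^ m) := by
  refine ⟨hσ.nontrivial, fun I hI => ?_⟩
  by_contra! hcon
  obtain ⟨d, hd, hd0⟩ := Submodule.exists_mem_ne_zero_of_ne_bot hcon.1
  have hbot := hσ.iInf_map_pow_eq_bot (Nat.pos_of_ne_zero hm) hI hcon.2
  have hne : ∏ i : Fin m, (σ ^ (i : ℕ)) d ≠ 0 :=
    Finset.prod_ne_zero_iff.2 fun i _ => (map_ne_zero_iff _ (σ ^ (i : ℕ)).injective).2 hd0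
  apply hne
  rw [← Ideal.mem_bot, ← hbot, Ideal.mem_iInf]
  intro i
  exact Ideal.mem_of_dvd _ (Finset.dvd_prod_of_mem _ (Finset.mem_univ i))
    (Ideal.mem_map_of_mem ((σ ^ (i : ℕ) : R ≃+* R) : R →+* R) hd)

/-- A Noetherian simple difference ring is a finite product of domains that are permuted
cyclically. -/
theorem IsDifferenceSimple.exists_isPrimeDecomposition {R : Type*} [CommRing R]
    [IsNoetherianRing R] {σ : R ≃+* R} (hσ : IsDifferenceSimple σ) :
    ∃ (ℓ : ℕ) (P : Ideal R), IsPrimeDecomposition σ ℓ P := by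
  classical
  have := hσ.nontrivial
  obtain ⟨P, hP⟩ := Ideal.nonempty_minimalPrimes (I := (⊥ : Ideal R)) bot_ne_top
  have hPp : P.IsPrime := hP.1.1
  let Q : ℕ → Ideal R := fun i => P.map ((σ ^ i : R ≃+* R) : R →+* R)
  have hQadd : ∀ i k, (Q i).map ((σ ^ k : R ≃+* R) : R →+* R) = Q (k + i) := fun i k =>
    Ideal.map_pow_map_pow σ P i k
  have hQ0 : Q 0 = P := Ideal.map_pow_zero σ P
  have hQp : ∀ i, (Q i).IsPrime := fun i => Ideal.map_isPrime_of_equiv (σ ^ i)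
  have hmapinj : ∀ k, Function.Injective
      (Ideal.map ((σ ^ k : R ≃+* R) : R →+* R)) := fun k I J hIJ => by
    ext x
    have := SetLike.ext_iff.1 hIJ ((σ ^ k) x)
    rwa [Ideal.mem_map_ringEquiv, Ideal.mem_map_ringEquiv, RingEquiv.symm_apply_apply] at this
  have hQmin : ∀ i, Q i ∈ minimalPrimes R := by
    intro i
    refine ⟨⟨hQp i, bot_le⟩, ?_⟩
    rintro J ⟨hJ, -⟩ hJQ
    have h1 : J.comap ((σ ^ i : R ≃+* R) : R →+* R) ≤ P := by
      intro x hx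
      have := hJQ hx
      rwa [Ideal.mem_map_ringEquiv, RingHom.coe_coe, RingEquiv.symm_apply_apply] at this
    have h2 := hP.2 ⟨Ideal.comap_isPrime _ J, bot_le⟩ h1
    exact Ideal.map_le_iff_le_comap.2 h2
  have hmineq : ∀ i, Q i ≤ P → Q i = P := fun i hi => le_antisymm hi (hP.2 (hQmin i).1 hi)
  have hex : ∃ ℓ, 0 < ℓ ∧ Q ℓ = P := by
    have hfin : Finite (minimalPrimes R) := minimalPrimes.finite_of_isNoetherianRing R
    obtain ⟨i, j, hij, heq⟩ := Finite.exists_ne_map_eq_of_infinite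
      (fun i : ℕ => (⟨Q i, hQmin i⟩ : minimalPrimes R))
    have heq' : Q i = Q j := congrArg Subtype.val heq
    have aux : ∀ i j, i < j → Q i = Q j → ∃ ℓ, 0 < ℓ ∧ Q ℓ = P := by
      intro i j hij heq
      refine ⟨j - i, by omega, ?_⟩
      apply hmapinj i
      rw [hQadd, Nat.add_sub_cancel' hij.le, ← heq]
    rcases lt_or_gt_of_ne hij with h | h
    · exact aux i j h heq'
    · exact aux j i h heq'.symm
  -- Minimality of the period `ℓ` makes the translates `Q 0, …, Q (ℓ - 1)` distinct.
  obtain ⟨hℓ, hQℓ⟩ := Nat.find_spec hex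
  have hQne : ∀ k, 0 < k → k < Nat.find hex → Q k ≠ P := fun k hk hkℓ h =>
    Nat.find_min hex hkℓ ⟨hk, h⟩
  generalize Nat.find hex = ℓ at hℓ hQℓ hQne
  have hstab : ∀ a ∈ P, (σ ^ ℓ) a ∈ P := fun a ha => by
    rw [← hQℓ]
    exact Ideal.mem_map_of_mem ((σ ^ ℓ : R ≃+* R) : R →+* R) ha
  -- The translates of a proper `J` intersect in zero, so one of them lies in the prime `P`. As `J`
  -- contains `P`, the corresponding `Q i` lies in `P`, hence equals it, and `i = 0` by minimality
  -- of `ℓ`.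
  have hmax : ∀ J : Ideal R, (∀ a ∈ J, (σ ^ ℓ) a ∈ J) → P ≤ J → J = P ∨ J = ⊤ := by
    intro J hJ hPJ
    by_contra! hcon
    have hbot := hσ.iInf_map_pow_eq_bot hℓ hJ hcon.2
    have hle : Finset.univ.inf (fun i : Fin ℓ => J.map ((σ ^ (i : ℕ) : R ≃+* R) : R →+* R)) ≤ P := by
      rw [Finset.inf_univ_eq_iInf, hbot]
      exact bot_le
    obtain ⟨i, -, hi⟩ := (Ideal.IsPrime.inf_le' hPp).1 hle
    have h1 : Q i = P := hmineq i ((Ideal.map_mono hPJ).trans hi)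
    rcases Nat.eq_zero_or_pos (i : ℕ) with h0 | h0
    · rw [h0, Ideal.map_pow_zero] at hi
      exact hcon.1 (le_antisymm hi hPJ)
    · exact hQne i h0 i.2 h1
  have hcop : ∀ k, 0 < k → k < ℓ → P ⊔ Q k = ⊤ := by
    intro k hk hkℓ
    refine (hmax _ ?_ le_sup_left).resolve_left fun h => ?_
    · have : (P ⊔ Q k).map ((σ ^ ℓ : R ≃+* R) : R →+* R) = P ⊔ Q k := by
        have hQk : Q (ℓ + k) = Q k := by rw [add_comm, ← hQadd, hQℓ]
        rw [Ideal.map_sup, hQadd, hQk]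
        exact congrArg (· ⊔ Q k) hQℓ
      intro a ha
      rw [← this]
      exact Ideal.mem_map_of_mem ((σ ^ ℓ : R ≃+* R) : R →+* R) ha
    · exact hQne k hk hkℓ (hmineq k (h ▸ le_sup_right))
  have hcop' : ∀ i j, i < j → j < ℓ → Q i ⊔ Q j = ⊤ := by
    intro i j hij hj
    have := congrArg (Ideal.map ((σ ^ i : R ≃+* R) : R →+* R)) (hcop (j - i) (by omega) (by omega))
    rwa [Ideal.map_sup, hQadd, Nat.add_sub_cancel' hij.le, Ideal.map_top] at this
  refine ⟨ℓ, P, hℓ, hPp, hQℓ.symm, hmax, ?_, ?_⟩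
  · rw [injective_iff_map_eq_zero]
    intro a ha
    rw [← Ideal.mem_bot, ← hσ.iInf_map_pow_eq_bot hℓ hstab hPp.ne_top, Ideal.mem_iInf]
    intro i
    exact Ideal.Quotient.eq_zero_iff_mem.1 (congrFun ha i)
  · refine Ideal.pi_mkQ_surjective (I := fun i : Fin ℓ => Q i) ?_
    intro i j hij
    rcases lt_or_gt_of_ne hij with h | h
    · exact Ideal.isCoprime_iff_sup_eq.2 (hcop' i j h j.2)
    · exact (Ideal.isCoprime_iff_sup_eq.2 (hcop' j i h i.2)).symm

/-! ### Periodic elements of simple difference domains -/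

/-- In a simple difference domain, nonzero periodic elements are invertible. -/
theorem IsDifferenceSimple.isUnit_of_periodic {R : Type*} [CommRing R] [IsDomain R]
    {σ : R ≃+* R} (hσ : IsDifferenceSimple σ) {a : R} (ha : a ∈ periodicSubmodule σ)
    (ha0 : a ≠ 0) : IsUnit a := by
  obtain ⟨m, hm, hma⟩ := ha
  exact (hσ.pow hm).isUnit_of_fixed hma ha0

theorem isAlgebraic_of_forall_isUnit {K S : Type*} [Field K] [CharZero K] [CommRing S]
    [Algebra K S] [Nontrivial S] [Algebra.FiniteType K S] {c : S}
    (hc : ∀ k : ℕ, c - k ≠ 0 → IsUnit (c - k)) : IsAlgebraic K c := by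
  by_cases h : ∃ k : ℕ, c - k = 0
  · obtain ⟨k, hk⟩ := h
    rw [sub_eq_zero.1 hk, ← map_natCast (algebraMap K S)]
    exact isAlgebraic_algebraMap _
  · push Not at h
    exact isAlgebraic_of_forall_isUnit_sub_natCast fun k => hc k (h k)

/-- The constants of a finitely generated simple difference algebra are algebraic. -/
theorem IsDifferenceSimple.isAlgebraic_of_fixed (K : Type*) {S : Type*} [Field K] [CharZero K]
    [CommRing S] [Algebra K S] [Algebra.FiniteType K S] {τ : S ≃+* S} (hτ : IsDifferenceSimple τ)
    {c : S} (hc : τ c = c) : IsAlgebraic K c := by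
  have := hτ.nontrivial
  exact isAlgebraic_of_forall_isUnit fun k =>
    hτ.isUnit_of_fixed (by rw [map_sub, map_natCast, hc])

theorem IsDifferenceSimple.isAlgebraic_of_periodic (K : Type*) {S : Type*} [Field K] [CharZero K]
    [CommRing S] [IsDomain S] [Algebra K S] [Algebra.FiniteType K S] {τ : S ≃+* S}
    (hτ : IsDifferenceSimple τ) {c : S} (hc : c ∈ periodicSubmodule τ) : IsAlgebraic K c := by
  refine isAlgebraic_of_forall_isUnit fun k => hτ.isUnit_of_periodic ?_
  obtain ⟨m, hm, hmc⟩ := hc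
  exact ⟨m, hm, by rw [map_sub, map_natCast, hmc]⟩

/-- In a finitely generated domain over a field, the algebraic elements form a finite extension. -/
theorem finite_algebraicClosure_of_finiteType (K S : Type*) [Field K] [CommRing S] [IsDomain S]
    [Algebra K S] [Algebra.FiniteType K S] : Module.Finite K (integralClosure K S) := by
  have hB : IsField (integralClosure K S) := isField_of_isIntegral_of_isField' (Field.toIsField K)
  let _ : Field (integralClosure K S) := hB.toField
  -- The algebraic elements form a field embedded in a finitely generated algebra, so Zariski's
  -- lemma bounds its degree.
  exact finite_of_algHom_finiteType_of_isJacobsonRing (integralClosure K S).val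

/-- If all periodic elements of `K` are constant, then the periodic elements of a finitely generated
simple difference domain over `K` have finite rank over the constants. -/
theorem IsDifferenceSimple.finite_periodicSubmodule_of_isDomain {K S : Type*} [Field K]
    [CharZero K] [CommRing S] [IsDomain S] [Algebra K S] [Algebra.FiniteType K S]
    {σ : K ≃+* K} {τ : S ≃+* S} (hτ : IsDifferenceSimple τ)
    (h : ∀ a, τ (algebraMap K S a) = algebraMap K S (σ a))
    (hK : ∀ (m : ℕ) (a : K), m ≠ 0 → (σ ^ m) a = a → σ a = a) :
    Module.Finite (fixedSubring τ) (periodicSubmodule τ) := by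
  classical
  have := finite_algebraicClosure_of_finiteType K S
  have hC := hτ.isField_fixedSubring
  have : Nontrivial (fixedSubring τ) := hC.nontrivial
  have := Module.Free.of_isField hC (periodicSubmodule τ)
  have hrank : Module.rank (fixedSubring τ) (periodicSubmodule τ) ≤
      (Module.finrank K (integralClosure K S) : ℕ) := by
    refine rank_le fun s hs => ?_
    obtain ⟨N, hN, hper⟩ := exists_common_period (σ := τ)
      (a := fun i : s => ((i : periodicSubmodule τ) : S)) (fun i => (i : periodicSubmodule τ).2)
    have hs' := hs.map' (periodicSubmodule τ).subtype (Submodule.ker_subtype _)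
    have hcompat : ∀ a, (τ ^ N) (algebraMap K S a) = algebraMap K S ((σ ^ N) a) :=
      pow_algebraMap_comm h N
    -- With a common period `N`, the elements are constants for `τ ^ N`. The constants of `σ ^ N` in
    -- `K` are constants of `σ` by `hK`, so independence over the constants of `S` passes to
    -- independence over `K`.
    have hli : LinearIndependent K fun i : s => ((i : periodicSubmodule τ) : S) := by
      refine (IsDifferenceSimple.of_field (σ ^ N)).linearIndependent_of_fixed hcompat hper ?_
      rw [Fintype.linearIndependent_iff]
      intro g hg i
      have hfix : ∀ j, algebraMap K S (g j : K) ∈ fixedSubring τ := fun j => by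
        rw [mem_fixedSubring, h, hK N _ hN (g j).2]
      have := Fintype.linearIndependent_iff.1 hs' (fun j => ⟨_, hfix j⟩) (by
        rw [← hg]
        refine Finset.sum_congr rfl fun j _ => ?_
        exact (Algebra.smul_def (g j : K) _).symm) i
      have h0 : algebraMap K S (g i : K) = 0 := congrArg Subtype.val this
      exact Subtype.ext ((map_eq_zero _).1 h0)
    let v : s → integralClosure K S := fun i =>
      ⟨((i : periodicSubmodule τ) : S),
        isAlgebraic_iff_isIntegral.1 (hτ.isAlgebraic_of_periodic K (i : periodicSubmodule τ).2)⟩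
    have hv : LinearIndependent K v :=
      LinearIndependent.of_comp (integralClosure K S).val.toLinearMap hli
    simpa using hv.fintype_card_le_finrank
  exact Module.rank_lt_aleph0_iff.1 (hrank.trans_lt (Cardinal.natCast_lt_aleph0))

/-- An element of the field of fractions of a simple difference domain that is fixed by a power of
the automorphism lies in the domain. -/
theorem IsDifferenceSimple.exists_algebraMap_eq_of_periodic {S F : Type*} [CommRing S] [IsDomain S]
    [Field F] [Algebra S F] [IsFractionRing S F] {τ : S ≃+* S} {τF : F ≃+* F}
    (hτ : IsDifferenceSimple τ) (h : ∀ s, τF (algebraMap S F s) = algebraMap S F (τ s)) {m : ℕ}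
    (hm : m ≠ 0) {x : F} (hx : (τF ^ m) x = x) : ∃ s : S, algebraMap S F s = x := by
  -- The ideal of denominators of `x` is stable under `τ ^ m` because `x` is fixed, and `τ ^ m` is
  -- still simple on a domain.
  let I : Ideal S :=
    { carrier := {r | ∃ s, algebraMap S F r * x = algebraMap S F s}
      add_mem' := by
        rintro a b ⟨s, hs⟩ ⟨t, ht⟩
        exact ⟨s + t, by rw [map_add, add_mul, hs, ht, map_add]⟩
      zero_mem' := ⟨0, by simp⟩
      smul_mem' := by
        rintro c a ⟨s, hs⟩
        exact ⟨c * s, by rw [smul_eq_mul, map_mul, mul_assoc, hs, map_mul]⟩ }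
  obtain ⟨a, d, hd, had⟩ := IsFractionRing.div_surjective (A := S) x
  have hd0 : d ≠ 0 := nonZeroDivisors.ne_zero hd
  have hdF : algebraMap S F d ≠ 0 :=
    (map_ne_zero_iff _ (IsFractionRing.injective S F)).2 hd0
  have hI : I = ⊤ := by
    refine (hτ.pow hm).eq_top ?_ (a := d) ⟨a, by rw [← had, mul_div_cancel₀ _ hdF]⟩ hd0
    rintro r ⟨s, hs⟩
    refine ⟨(τ ^ m) s, ?_⟩
    have := congrArg (τF ^ m) hs
    rwa [map_mul, pow_algebraMap_comm h, hx, pow_algebraMap_comm h] at this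
  obtain ⟨s, hs⟩ := show (1 : S) ∈ I from hI ▸ Submodule.mem_top
  exact ⟨s, by rw [← hs, map_one, one_mul]⟩

theorem constantField_le_periodicField {F : Type*} [Field F] (σ : F ≃+* F) :
    constantField σ ≤ periodicField σ :=
  fun a (ha : σ a = a) => ⟨1, one_ne_zero, by rwa [pow_one]⟩

/-- The degree `[D_F : D_K C_F]`, where `F` is the field of fractions of a simple difference domain
in which the elements of `D_K` are constant, can be computed in the domain. -/
theorem IsDifferenceSimple.periodicDegree_eq_rank {K S : Type*} [Field K] [CommRing S] [IsDomain S]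
    [Algebra K S] {σ : K ≃+* K} {τ : S ≃+* S} (hτ : IsDifferenceSimple τ)
    (hK : ∀ a ∈ periodicField σ, τ (algebraMap K S a) = algebraMap K S a) :
    periodicDegree σ (FractionRing S) (IsFractionRing.ringEquivOfRingEquiv τ) =
      Module.rank (fixedSubring τ) (periodicSubmodule τ) := by
  set τF : FractionRing S ≃+* FractionRing S := IsFractionRing.ringEquivOfRingEquiv τ with hτF
  have h : ∀ s, τF (algebraMap S _ s) = algebraMap S _ (τ s) := fun s =>
    IsFractionRing.ringEquivOfRingEquiv_algebraMap τ s
  have hinj : Function.Injective (algebraMap S (FractionRing S)) :=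
    IsFractionRing.injective S (FractionRing S)
  have hle : (periodicField σ).map (algebraMap K (FractionRing S)) ≤ constantField τF := by
    rintro _ ⟨a, ha, rfl⟩
    change τF (algebraMap K (FractionRing S) a) = algebraMap K (FractionRing S) a
    rw [IsScalarTower.algebraMap_apply K S (FractionRing S), h, hK a ha]
  have hCD := constantField_le_periodicField τF
  rw [periodicDegree, sup_eq_right.2 hle, Subfield.relrank_eq_rank_of_le hCD]
  have hC : ∀ c : fixedSubring τ, algebraMap S (FractionRing S) c ∈ constantField τF := fun c => by
    change τF _ = _
    rw [h, mem_fixedSubring.1 c.2]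
  have hD : ∀ d : periodicSubmodule τ, algebraMap S (FractionRing S) d ∈
      Subfield.extendScalars hCD := by
    rintro ⟨d, m, hm, hd⟩
    exact ⟨m, hm, (pow_algebraMap_comm h m d).trans (congrArg _ hd)⟩
  let i : fixedSubring τ → constantField τF := fun c => ⟨_, hC c⟩
  let j : periodicSubmodule τ →+ Subfield.extendScalars hCD :=
    { toFun := fun d => ⟨_, hD d⟩
      map_zero' := Subtype.ext (map_zero _)
      map_add' := fun a b => Subtype.ext (map_add _ _ _) }
  have hi : Function.Bijective i := by
    refine ⟨fun a b hab => Subtype.ext (hinj (congrArg Subtype.val hab)), ?_⟩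
    rintro ⟨x, hx⟩
    obtain ⟨s, rfl⟩ := hτ.exists_algebraMap_eq_of_periodic h one_ne_zero
      (show (τF ^ 1) x = x by rwa [pow_one])
    refine ⟨⟨s, hinj ?_⟩, rfl⟩
    rw [← h]
    exact hx
  have hj : Function.Bijective j := by
    refine ⟨fun a b hab => Subtype.ext (hinj (congrArg Subtype.val hab)), ?_⟩
    rintro ⟨x, hx⟩
    obtain ⟨m, hm, hmx⟩ := hx
    obtain ⟨s, rfl⟩ := hτ.exists_algebraMap_eq_of_periodic h hm hmx
    refine ⟨⟨s, m, hm, hinj ?_⟩, rfl⟩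
    rw [← pow_algebraMap_comm h]
    exact hmx
  exact (rank_eq_of_equiv_equiv i (AddEquiv.ofBijective j hj) hi fun c d =>
    Subtype.ext (map_mul (algebraMap S (FractionRing S)) (c : S) (d : S))).symm

/-! ### From the domain `R/P` back to `R` -/

namespace IsPrimeDecomposition

variable {R : Type*} [CommRing R] {σ : R ≃+* R} {ℓ : ℕ} {P : Ideal R}

/-- The automorphism of `R/P` induced by `σ^ℓ`. -/
noncomputable def quotientAut (h : IsPrimeDecomposition σ ℓ P) : R ⧸ P ≃+* R ⧸ P :=
  Ideal.quotientEquiv P P (σ ^ ℓ) h.stable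

theorem quotientAut_mk (h : IsPrimeDecomposition σ ℓ P) (r : R) :
    h.quotientAut (Ideal.Quotient.mk P r) = Ideal.Quotient.mk P ((σ ^ ℓ) r) := rfl

theorem quotientAut_pow_mk (h : IsPrimeDecomposition σ ℓ P) (m : ℕ) (r : R) :
    (h.quotientAut ^ m) (Ideal.Quotient.mk P r) = Ideal.Quotient.mk P ((σ ^ (ℓ * m)) r) := by
  rw [pow_mul]
  exact pow_algebraMap_comm (fun r => h.quotientAut_mk r) m r

theorem isDifferenceSimple_quotientAut (h : IsPrimeDecomposition σ ℓ P) :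
    IsDifferenceSimple h.quotientAut := by
  refine ⟨Ideal.Quotient.nontrivial_iff.2 h.isPrime.ne_top, fun J hJ => ?_⟩
  have hP : P = Ideal.comap (Ideal.Quotient.mk P) ⊥ := by
    rw [← RingHom.ker_eq_comap_bot, Ideal.mk_ker]
  have hsurj : Function.Surjective (Ideal.Quotient.mk P) := Ideal.Quotient.mk_surjective
  rcases h.maximal (J.comap (Ideal.Quotient.mk P)) (fun a ha => hJ _ ha)
    (by conv_lhs => rw [hP]
        exact Ideal.comap_mono bot_le) with h' | h'
  · left
    apply Ideal.comap_injective_of_surjective _ hsurj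
    rw [h', ← hP]
  · right
    apply Ideal.comap_injective_of_surjective _ hsurj
    rw [h', Ideal.comap_top]

/-- The `i`-th component `r ↦ σ⁻ⁱ(r) mod P` of the decomposition of `R`. -/
noncomputable def component (_ : IsPrimeDecomposition σ ℓ P) : R →+* (Fin ℓ → R ⧸ P) :=
  RingHom.pi fun i : Fin ℓ => (Ideal.Quotient.mk P).comp
    (((σ ^ (i : ℕ)).symm : R ≃+* R) : R →+* R)

theorem component_apply (h : IsPrimeDecomposition σ ℓ P) (r : R) (i : Fin ℓ) :
    h.component r i = Ideal.Quotient.mk P ((σ ^ (i : ℕ)).symm r) := rfl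

/-- The map `σ⁻ⁱ` identifies `R/σⁱ(P)` with `R/P`, so this is the given decomposition with all its
factors made equal. -/
theorem component_bijective (h : IsPrimeDecomposition σ ℓ P) :
    Function.Bijective h.component := by
  constructor
  · rw [injective_iff_map_eq_zero]
    intro r hr
    apply (injective_iff_map_eq_zero _).1 h.bijective.1
    funext i
    have := congrFun hr i
    rw [component_apply, Pi.zero_apply, Ideal.Quotient.eq_zero_iff_mem] at this
    exact Ideal.Quotient.eq_zero_iff_mem.2 ((Ideal.mem_map_ringEquiv _).2 this)
  · intro y
    choose s hs using fun i => Ideal.Quotient.mk_surjective (y i)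
    obtain ⟨r, hr⟩ := h.bijective.2 fun i => Ideal.Quotient.mk _ ((σ ^ (i : ℕ)) (s i))
    refine ⟨r, funext fun i => ?_⟩
    rw [component_apply, ← hs i, Ideal.Quotient.mk_eq_mk_iff_sub_mem]
    have := Ideal.Quotient.mk_eq_mk_iff_sub_mem _ _ |>.1 (congrFun hr i)
    rwa [Ideal.mem_map_ringEquiv, map_sub, RingEquiv.symm_apply_apply] at this

theorem component_pow (h : IsPrimeDecomposition σ ℓ P) (m : ℕ) (r : R) (i : Fin ℓ) :
    h.component ((σ ^ (ℓ * m)) r) i = (h.quotientAut ^ m) (h.component r i) := by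
  rw [component_apply, component_apply, quotientAut_pow_mk]
  congr 1
  rw [RingEquiv.symm_apply_eq, ← RingAut.mul_apply, ← pow_add, add_comm, pow_add,
    RingAut.mul_apply, RingEquiv.apply_symm_apply]

theorem symm_pow_apply_of_fixed {r : R} (hr : σ r = r) (k : ℕ) : (σ ^ k).symm r = r := by
  rw [RingEquiv.symm_apply_eq, pow_apply_of_fixed hr]

/-- `σ ^ (ℓ * m)` acts on each component by the `m`-th power of `quotientAut`, and finitely many
components have a common period. -/
theorem component_mem_periodic_iff (h : IsPrimeDecomposition σ ℓ P) (r : R) :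
    (∀ i, h.component r i ∈ periodicSubmodule h.quotientAut) ↔ r ∈ periodicSubmodule σ := by
  constructor
  · intro hr
    obtain ⟨m, hm, hmr⟩ := exists_common_period hr
    refine ⟨ℓ * m, mul_ne_zero h.pos.ne' hm, h.component_bijective.1 (funext fun i => ?_)⟩
    rw [component_pow, hmr]
  · rintro ⟨m, hm, hmr⟩ i
    exact ⟨m, hm, by rw [← component_pow, pow_apply_of_dvd hmr (dvd_mul_left m ℓ)]⟩

/-- `σ` shifts the components cyclically, applying `quotientAut` at the wrap-around. The element
with all components equal to `c` is therefore fixed. -/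
theorem exists_fixed_of_fixed (h : IsPrimeDecomposition σ ℓ P) {c : R ⧸ P}
    (hc : h.quotientAut c = c) : ∃ r, σ r = r ∧ Ideal.Quotient.mk P r = c := by
  obtain ⟨r, hr⟩ := h.component_bijective.2 fun _ => c
  have hri : ∀ i : Fin ℓ, Ideal.Quotient.mk P ((σ ^ (i : ℕ)).symm r) = c := fun i => congrFun hr i
  refine ⟨r, h.component_bijective.1 ?_, ?_⟩
  · rw [hr]
    funext ⟨i, hi⟩
    rw [component_apply]
    rcases i with _ | i
    · have h1 := congrArg h.quotientAut (hri ⟨ℓ - 1, by have := h.pos; omega⟩)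
      have h2 : σ ^ ℓ = σ * σ ^ (ℓ - 1) := by rw [← pow_succ', Nat.sub_add_cancel h.pos]
      rw [hc, quotientAut_mk, h2, RingAut.mul_apply, RingEquiv.apply_symm_apply] at h1
      exact h1
    · rw [← hri ⟨i, by omega⟩]
      congr 1
      rw [RingEquiv.symm_apply_eq, pow_succ', RingAut.mul_apply, RingEquiv.apply_symm_apply]
  · exact hri ⟨0, h.pos⟩

/-- The rank of the periodic elements of `R` is `ℓ` times that of the periodic elements of `R/P`. -/
theorem rank_periodicSubmodule (h : IsPrimeDecomposition σ ℓ P) :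
    Module.rank (fixedSubring σ) (periodicSubmodule σ) =
      ℓ * Module.rank (fixedSubring h.quotientAut) (periodicSubmodule h.quotientAut) := by
  have hC := h.isDifferenceSimple_quotientAut.isField_fixedSubring
  have : Nontrivial (fixedSubring h.quotientAut) := hC.nontrivial
  have := Module.Free.of_isField hC (periodicSubmodule h.quotientAut)
  have hfix : ∀ c : fixedSubring σ, Ideal.Quotient.mk P (c : R) ∈ fixedSubring h.quotientAut :=
    fun c => by rw [mem_fixedSubring, quotientAut_mk, pow_apply_of_fixed c.2]
  have hcomp : ∀ (c : fixedSubring σ) (i : Fin ℓ), h.component c i = Ideal.Quotient.mk P (c : R) :=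
    fun c i => by rw [component_apply, symm_pow_apply_of_fixed c.2]
  let ι : fixedSubring σ → fixedSubring h.quotientAut := fun c => ⟨_, hfix c⟩
  let j : periodicSubmodule σ →+ (Fin ℓ → periodicSubmodule h.quotientAut) :=
    { toFun := fun d i => ⟨h.component d i, (h.component_mem_periodic_iff d).2 d.2 i⟩
      map_zero' := funext fun i => Subtype.ext (congrFun (map_zero h.component) i)
      map_add' := fun a b => funext fun i =>
        Subtype.ext (congrFun (map_add h.component (a : R) (b : R)) i) }
  have hι : Function.Bijective ι := by
    constructor
    · intro a b hab
      refine Subtype.ext (h.component_bijective.1 (funext fun i => ?_))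
      rw [hcomp, hcomp]
      exact congrArg Subtype.val hab
    · rintro ⟨c, hc⟩
      obtain ⟨r, hr, hrc⟩ := h.exists_fixed_of_fixed hc
      exact ⟨⟨r, hr⟩, Subtype.ext hrc⟩
  have hj : Function.Bijective j := by
    constructor
    · intro a b hab
      exact Subtype.ext (h.component_bijective.1 (funext fun i =>
        congrArg Subtype.val (congrFun hab i)))
    · intro y
      obtain ⟨r, hr⟩ := h.component_bijective.2 fun i => (y i : R ⧸ P)
      refine ⟨⟨r, (h.component_mem_periodic_iff r).1 fun i => ?_⟩, funext fun i => Subtype.ext ?_⟩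
      · rw [congrFun hr i]
        exact (y i).2
      · exact congrFun hr i
  rw [rank_eq_of_equiv_equiv ι (AddEquiv.ofBijective j hj) hι, rank_fun_eq_lift_mul,
    Fintype.card_fin, Cardinal.lift_uzero]
  intro c d
  refine funext fun i => Subtype.ext ?_
  change h.component ((c : R) * (d : R)) i = Ideal.Quotient.mk P (c : R) * h.component (d : R) i
  rw [map_mul, Pi.mul_apply, hcomp]

end IsPrimeDecomposition

/-! ### The invariant as a rank -/

/-- The `m`-invariant of a finitely generated simple difference algebra over a field whose periodic
elements are constant is the rank of its periodic elements over its constants. -/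
theorem IsDifferenceSimple.finite_periodicSubmodule_and_hasMInvariant {K R : Type*} [Field K]
    [CharZero K] [CommRing R] [Algebra K R] [Algebra.FiniteType K R] {σK : K ≃+* K} {σ : R ≃+* R}
    (hσ : IsDifferenceSimple σ) (h : ∀ a, σ (algebraMap K R a) = algebraMap K R (σK a))
    (hK : constantField σK = periodicField σK) :
    Module.Finite (fixedSubring σ) (periodicSubmodule σ) ∧
      HasMInvariant σK R σ (Module.finrank (fixedSubring σ) (periodicSubmodule σ)) := by
  have : IsNoetherianRing R := Algebra.FiniteType.isNoetherianRing K R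
  have hK' : ∀ a ∈ periodicField σK, σK a = a := fun a ha => by
    rw [← hK] at ha
    exact ha
  have hC := hσ.isField_fixedSubring
  have : Nontrivial (fixedSubring σ) := hC.nontrivial
  have := Module.Free.of_isField hC (periodicSubmodule σ)
  -- On `R/P` the automorphism extends `σK ^ ℓ`; its periodic elements in `K` are periodic for `σK`,
  -- hence constant.
  have hfinP : ∀ {ℓ P} (d : IsPrimeDecomposition σ ℓ P),
      Module.Finite (fixedSubring d.quotientAut) (periodicSubmodule d.quotientAut) := by
    intro ℓ P d
    have := d.isPrime
    refine d.isDifferenceSimple_quotientAut.finite_periodicSubmodule_of_isDomain (K := K)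
      (σ := σK ^ ℓ) (fun a => ?_) (fun m a hm ha => ?_)
    · change d.quotientAut (Ideal.Quotient.mk P (algebraMap K R a)) = _
      rw [d.quotientAut_mk, pow_algebraMap_comm h]
      rfl
    · rw [← pow_mul] at ha
      exact pow_apply_of_fixed (hK' a ⟨_, mul_ne_zero d.pos.ne' hm, ha⟩) ℓ
  have hfin : Module.Finite (fixedSubring σ) (periodicSubmodule σ) := by
    obtain ⟨ℓ, P, d⟩ := hσ.exists_isPrimeDecomposition
    have hd := d.isDifferenceSimple_quotientAut.isField_fixedSubring
    have : Nontrivial (fixedSubring d.quotientAut) := hd.nontrivial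
    have := Module.Free.of_isField hd (periodicSubmodule d.quotientAut)
    rw [← Module.rank_lt_aleph0_iff, d.rank_periodicSubmodule]
    exact Cardinal.mul_lt_aleph0 Cardinal.natCast_lt_aleph0
      (Module.rank_lt_aleph0_iff.2 (hfinP d))
  refine ⟨hfin, hσ.exists_isPrimeDecomposition, fun ℓ P d => ?_⟩
  have := d.isPrime
  rw [Module.finrank_eq_rank, d.rank_periodicSubmodule]
  congr 1
  refine d.isDifferenceSimple_quotientAut.periodicDegree_eq_rank fun a ha => ?_
  change d.quotientAut (Ideal.Quotient.mk P (algebraMap K R a)) = _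
  rw [d.quotientAut_mk, pow_algebraMap_comm h, pow_apply_of_fixed (hK' a ha)]
  rfl

/-! ### A common simple extension of two difference algebras -/

-- Ring homomorphisms are used because the automorphisms to be tensored are only semilinear over
-- `K`.
open TensorProduct in
theorem exists_ringHom_tensorProduct {K R₁ R₂ T : Type*} [CommRing K] [CommRing R₁] [CommRing R₂]
    [CommRing T] [Algebra K R₁] [Algebra K R₂] (g₁ : R₁ →+* T) (g₂ : R₂ →+* T)
    (h : ∀ a, g₁ (algebraMap K R₁ a) = g₂ (algebraMap K R₂ a)) :
    ∃ f : R₁ ⊗[K] R₂ →+* T, (∀ a, f (a ⊗ₜ 1) = g₁ a) ∧ ∀ b, f (1 ⊗ₜ b) = g₂ b := by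
  let _ : Algebra K T := (g₁.comp (algebraMap K R₁)).toAlgebra
  let G₁ : R₁ →ₐ[K] T := { g₁ with commutes' := fun _ => rfl }
  let G₂ : R₂ →ₐ[K] T := { g₂ with commutes' := fun a => (h a).symm }
  refine ⟨(Algebra.TensorProduct.productMap G₁ G₂ : R₁ ⊗[K] R₂ →+* T), fun a => ?_, fun b => ?_⟩
  · exact Algebra.TensorProduct.productMap_left_apply G₁ G₂ a
  · exact Algebra.TensorProduct.productMap_right_apply G₁ G₂ b

open TensorProduct in
theorem ringHom_tensorProduct_ext {K R₁ R₂ T : Type*} [CommRing K] [CommRing R₁] [CommRing R₂]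
    [CommRing T] [Algebra K R₁] [Algebra K R₂] {f g : R₁ ⊗[K] R₂ →+* T}
    (h₁ : ∀ a, f (a ⊗ₜ 1) = g (a ⊗ₜ 1)) (h₂ : ∀ b, f (1 ⊗ₜ b) = g (1 ⊗ₜ b)) : f = g := by
  refine RingHom.ext fun x => ?_
  induction x with
  | zero => simp
  | add x y hx hy => rw [map_add, map_add, hx, hy]
  | tmul a b =>
    have : (a ⊗ₜ[K] b : R₁ ⊗[K] R₂) = a ⊗ₜ 1 * 1 ⊗ₜ b := by simp
    rw [this, map_mul, map_mul, h₁, h₂]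

open TensorProduct in
/-- The tensor product of two difference algebras is a difference algebra. -/
theorem exists_ringEquiv_tensorProduct {K R₁ R₂ : Type*} [CommRing K] [CommRing R₁] [CommRing R₂]
    [Algebra K R₁] [Algebra K R₂] {σ : K ≃+* K} {σ₁ : R₁ ≃+* R₁} {σ₂ : R₂ ≃+* R₂}
    (h₁ : ∀ a, σ₁ (algebraMap K R₁ a) = algebraMap K R₁ (σ a))
    (h₂ : ∀ a, σ₂ (algebraMap K R₂ a) = algebraMap K R₂ (σ a)) :
    ∃ τ : R₁ ⊗[K] R₂ ≃+* R₁ ⊗[K] R₂,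
      (∀ a, τ (a ⊗ₜ 1) = σ₁ a ⊗ₜ 1) ∧ ∀ b, τ (1 ⊗ₜ b) = 1 ⊗ₜ σ₂ b := by
  have hK : ∀ a : K, (algebraMap K R₁ a ⊗ₜ[K] (1 : R₂)) = (1 : R₁) ⊗ₜ[K] algebraMap K R₂ a :=
    fun a => Algebra.TensorProduct.tmul_one_eq_one_tmul a
  have aux : ∀ (ρ : K ≃+* K) (ρ₁ : R₁ ≃+* R₁) (ρ₂ : R₂ ≃+* R₂),
      (∀ a, ρ₁ (algebraMap K R₁ a) = algebraMap K R₁ (ρ a)) →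
      (∀ a, ρ₂ (algebraMap K R₂ a) = algebraMap K R₂ (ρ a)) →
      ∃ f : R₁ ⊗[K] R₂ →+* R₁ ⊗[K] R₂,
        (∀ a, f (a ⊗ₜ 1) = ρ₁ a ⊗ₜ 1) ∧ ∀ b, f (1 ⊗ₜ b) = 1 ⊗ₜ ρ₂ b := by
    intro ρ ρ₁ ρ₂ hρ₁ hρ₂
    exact exists_ringHom_tensorProduct
      ((Algebra.TensorProduct.includeLeftRingHom : R₁ →+* R₁ ⊗[K] R₂).comp (ρ₁ : R₁ →+* R₁))
      (((Algebra.TensorProduct.includeRight : R₂ →ₐ[K] R₁ ⊗[K] R₂) : R₂ →+* R₁ ⊗[K] R₂).comp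
        (ρ₂ : R₂ →+* R₂)) fun a => by
          change ρ₁ (algebraMap K R₁ a) ⊗ₜ[K] (1 : R₂) = (1 : R₁) ⊗ₜ[K] ρ₂ (algebraMap K R₂ a)
          rw [hρ₁, hρ₂, hK]
  obtain ⟨f, hf₁, hf₂⟩ := aux σ σ₁ σ₂ h₁ h₂
  obtain ⟨g, hg₁, hg₂⟩ := aux σ.symm σ₁.symm σ₂.symm
    (fun a => by rw [RingEquiv.symm_apply_eq, h₁, RingEquiv.apply_symm_apply])
    (fun a => by rw [RingEquiv.symm_apply_eq, h₂, RingEquiv.apply_symm_apply])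
  exact ⟨RingEquiv.ofRingHom f g
    (ringHom_tensorProduct_ext (fun a => by simp [hf₁, hg₁]) (fun b => by simp [hf₂, hg₂]))
    (ringHom_tensorProduct_ext (fun a => by simp [hf₁, hg₁]) (fun b => by simp [hf₂, hg₂])),
    hf₁, hf₂⟩

/-- A nonzero Noetherian difference ring has a simple quotient. -/
theorem exists_isDifferenceSimple_quotient {T : Type*} [CommRing T] [IsNoetherianRing T]
    [Nontrivial T] (τ : T ≃+* T) :
    ∃ (M : Ideal T) (ρ : T ⧸ M ≃+* T ⧸ M), IsDifferenceSimple ρ ∧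
      ∀ t, ρ (Ideal.Quotient.mk M t) = Ideal.Quotient.mk M (τ t) := by
  obtain ⟨M, ⟨hM, hMt⟩, hmax⟩ : ∃ M : Ideal T, ((∀ a ∈ M, τ a ∈ M) ∧ M ≠ ⊤) ∧
      ∀ J : Ideal T, (∀ a ∈ J, τ a ∈ J) ∧ J ≠ ⊤ → ¬M < J :=
    set_has_maximal_iff_noetherian.2 ‹IsNoetherianRing T›
      {J : Ideal T | (∀ a ∈ J, τ a ∈ J) ∧ J ≠ ⊤} ⟨⊥, by simp, bot_ne_top⟩
  have hmax' : ∀ J : Ideal T, (∀ a ∈ J, τ a ∈ J) → M ≤ J → J = M ∨ J = ⊤ := by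
    intro J hJ hMJ
    by_contra! hcon
    exact hmax J ⟨hJ, hcon.2⟩ (lt_of_le_of_ne hMJ hcon.1.symm)
  -- Stability of `M` says only that `M` lies in its preimage; maximality gives equality, so that
  -- `τ` induces an automorphism of the quotient.
  have hcomap : Ideal.comap (τ : T →+* T) M = M :=
    (hmax' (Ideal.comap (τ : T →+* T) M) (fun a ha => hM _ ha) hM).resolve_right
      (Ideal.comap_ne_top _ hMt)
  have hmap : M = M.map (τ : T →+* T) := by
    conv_rhs => rw [← hcomap]
    exact (Ideal.map_comap_of_surjective _ τ.surjective M).symm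
  refine ⟨M, Ideal.quotientEquiv M M τ hmap, ⟨Ideal.Quotient.nontrivial_iff.2 hMt, fun J hJ => ?_⟩,
    fun t => rfl⟩
  have hM' : M = Ideal.comap (Ideal.Quotient.mk M) ⊥ := by
    rw [← RingHom.ker_eq_comap_bot, Ideal.mk_ker]
  have hsurj : Function.Surjective (Ideal.Quotient.mk M) := Ideal.Quotient.mk_surjective
  rcases hmax' (J.comap (Ideal.Quotient.mk M)) (fun a ha => hJ _ ha)
    (by conv_lhs => rw [hM']
        exact Ideal.comap_mono bot_le) with h' | h'
  · left
    apply Ideal.comap_injective_of_surjective _ hsurj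
    rw [h', ← hM']
  · right
    apply Ideal.comap_injective_of_surjective _ hsurj
    rw [h', Ideal.comap_top]

open TensorProduct in
/-- Two finitely generated difference algebras over a field have a common simple difference
extension that they generate. -/
theorem exists_isDifferenceSimple_compositum.{v, w} {K : Type*} {R₁ : Type v} {R₂ : Type w}
    [Field K] [CommRing R₁] [CommRing R₂] [Algebra K R₁] [Algebra K R₂] [Nontrivial R₁] [Nontrivial R₂]
    [Algebra.FiniteType K R₁] [Algebra.FiniteType K R₂]
    {σ : K ≃+* K} {σ₁ : R₁ ≃+* R₁} {σ₂ : R₂ ≃+* R₂}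
    (h₁ : ∀ a, σ₁ (algebraMap K R₁ a) = algebraMap K R₁ (σ a))
    (h₂ : ∀ a, σ₂ (algebraMap K R₂ a) = algebraMap K R₂ (σ a)) :
    ∃ (S : Type (max v w)) (_ : CommRing S) (_ : Algebra K S) (_ : Algebra R₁ S)
      (_ : Algebra R₂ S) (τ : S ≃+* S), IsScalarTower K R₁ S ∧ IsScalarTower K R₂ S ∧
      Algebra.FiniteType K S ∧ IsDifferenceSimple τ ∧
      (∀ r, τ (algebraMap R₁ S r) = algebraMap R₁ S (σ₁ r)) ∧
      (∀ r, τ (algebraMap R₂ S r) = algebraMap R₂ S (σ₂ r)) ∧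
      ∀ W : Subring S, (algebraMap R₁ S).range ≤ W → (algebraMap R₂ S).range ≤ W → W = ⊤ := by
  have : Algebra.FiniteType K (R₁ ⊗[K] R₂) :=
    Algebra.FiniteType.trans (S := R₁) inferInstance inferInstance
  have : IsNoetherianRing (R₁ ⊗[K] R₂) := Algebra.FiniteType.isNoetherianRing K _
  obtain ⟨τ, hτ₁, hτ₂⟩ := exists_ringEquiv_tensorProduct h₁ h₂
  obtain ⟨M, ρ, hρ, hρτ⟩ := exists_isDifferenceSimple_quotient τ
  let j₁ : R₁ →+* (R₁ ⊗[K] R₂) ⧸ M :=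
    (Ideal.Quotient.mk M).comp Algebra.TensorProduct.includeLeftRingHom
  let j₂ : R₂ →+* (R₁ ⊗[K] R₂) ⧸ M := (Ideal.Quotient.mk M).comp
    ((Algebra.TensorProduct.includeRight : R₂ →ₐ[K] R₁ ⊗[K] R₂) : R₂ →+* R₁ ⊗[K] R₂)
  refine ⟨(R₁ ⊗[K] R₂) ⧸ M, inferInstance, inferInstance, j₁.toAlgebra, j₂.toAlgebra, ρ,
    ?_, ?_, Algebra.FiniteType.of_surjective (Ideal.Quotient.mkₐ K M)
      (Ideal.Quotient.mkₐ_surjective K M), hρ, ?_, ?_, ?_⟩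
  · let _ := j₁.toAlgebra
    exact IsScalarTower.of_algebraMap_eq fun a => rfl
  · let _ := j₂.toAlgebra
    refine IsScalarTower.of_algebraMap_eq fun a => ?_
    exact congrArg (Ideal.Quotient.mk M) (Algebra.TensorProduct.tmul_one_eq_one_tmul a)
  · intro r
    exact (hρτ _).trans (congrArg _ (hτ₁ r))
  · intro r
    exact (hρτ _).trans (congrArg _ (hτ₂ r))
  · intro W hW₁ hW₂
    rw [eq_top_iff]
    rintro s -
    obtain ⟨t, rfl⟩ := Ideal.Quotient.mk_surjective s
    induction t with
    | zero => rw [map_zero]; exact W.zero_mem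
    | add x y hx hy => rw [map_add]; exact W.add_mem hx hy
    | tmul a b =>
      have : (a ⊗ₜ[K] b : R₁ ⊗[K] R₂) = a ⊗ₜ 1 * 1 ⊗ₜ b := by simp
      rw [this, map_mul]
      exact W.mul_mem (hW₁ ⟨a, rfl⟩) (hW₂ ⟨b, rfl⟩)

/-! ### Comparison of Picard-Vessiot rings -/

namespace IsPicardVessiotRing

variable {K : Type*} [Field K] {σK : K ≃+* K} {n : ℕ} {A : Matrix.GeneralLinearGroup (Fin n) K}

theorem isDifferenceSimple {R : Type*} [CommRing R] [Algebra K R] {σ : R ≃+* R}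
    (h : IsPicardVessiotRing σK A R σ) : IsDifferenceSimple σ :=
  ⟨h.nontrivial, h.simple⟩

theorem finiteType {R : Type*} [CommRing R] [Algebra K R] {σ : R ≃+* R}
    (h : IsPicardVessiotRing σK A R σ) : Algebra.FiniteType K R := by
  obtain ⟨Z, -, hZ⟩ := h.exists_fundamental
  refine ⟨Subalgebra.fg_def.2 ⟨_, ?_, hZ⟩⟩
  refine Set.Finite.insert _ ((Set.finite_range fun p : Fin n × Fin n =>
    (Z : Matrix (Fin n) (Fin n) R) p.1 p.2).subset ?_)
  rintro _ ⟨i, j, rfl⟩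
  exact ⟨(i, j), rfl⟩

/-- A difference ring generated by two Picard-Vessiot rings for the same equation is generated by
each of them together with its constants. -/
theorem span_fixed_eq_top {R₁ R₂ S : Type*} [CommRing R₁] [CommRing R₂] [CommRing S] [Algebra K R₁]
    [Algebra K R₂] [Algebra K S] [Algebra R₁ S] [Algebra R₂ S] [IsScalarTower K R₁ S]
    [IsScalarTower K R₂ S] {σ₁ : R₁ ≃+* R₁} {σ₂ : R₂ ≃+* R₂} {τ : S ≃+* S}
    (h₁ : IsPicardVessiotRing σK A R₁ σ₁) (h₂ : IsPicardVessiotRing σK A R₂ σ₂)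
    (hτ₁ : ∀ r, τ (algebraMap R₁ S r) = algebraMap R₁ S (σ₁ r))
    (hτ₂ : ∀ r, τ (algebraMap R₂ S r) = algebraMap R₂ S (σ₂ r))
    (hgen : ∀ W : Subring S, (algebraMap R₁ S).range ≤ W → (algebraMap R₂ S).range ≤ W → W = ⊤) :
    Submodule.span R₁ {s : S | τ s = s} = ⊤ := by
  obtain ⟨Z₁, hZ₁, -⟩ := h₁.exists_fundamental
  obtain ⟨Z₂, hZ₂, hZ₂gen⟩ := h₂.exists_fundamental
  let B := Matrix.GeneralLinearGroup.map (n := Fin n) (algebraMap K S) A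
  let Y₁ := Matrix.GeneralLinearGroup.map (n := Fin n) (algebraMap R₁ S) Z₁
  let Y₂ := Matrix.GeneralLinearGroup.map (n := Fin n) (algebraMap R₂ S) Z₂
  let T := Matrix.GeneralLinearGroup.map (n := Fin n) (τ : S →+* S)
  have hT₁ : T Y₁ = B * Y₁ := by
    refine Matrix.GeneralLinearGroup.ext fun i j => ?_
    have := congrArg (algebraMap R₁ S) (congrFun (congrFun hZ₁ i) j)
    rw [Matrix.map_apply, ← hτ₁, Matrix.mul_apply, map_sum] at this
    refine Eq.trans this (Eq.symm ?_)
    rw [Units.val_mul, Matrix.mul_apply]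
    refine Finset.sum_congr rfl fun k _ => ?_
    rw [map_mul, Matrix.map_apply, ← IsScalarTower.algebraMap_apply]
    rfl
  have hT₂ : T Y₂ = B * Y₂ := by
    refine Matrix.GeneralLinearGroup.ext fun i j => ?_
    have := congrArg (algebraMap R₂ S) (congrFun (congrFun hZ₂ i) j)
    rw [Matrix.map_apply, ← hτ₂, Matrix.mul_apply, map_sum] at this
    refine Eq.trans this (Eq.symm ?_)
    rw [Units.val_mul, Matrix.mul_apply]
    refine Finset.sum_congr rfl fun k _ => ?_
    rw [map_mul, Matrix.map_apply, ← IsScalarTower.algebraMap_apply]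
    rfl
  -- Both matrices solve the same equation, so `B` cancels and `U` is constant.
  let U := Y₁⁻¹ * Y₂
  have hU : T U = U := by
    change T (Y₁⁻¹ * Y₂) = Y₁⁻¹ * Y₂
    rw [map_mul, map_inv, hT₁, hT₂]
    group
  have hYU : Y₂ = Y₁ * U := (mul_inv_cancel_left Y₁ Y₂).symm
  have hUfix : ∀ i j, τ ((U : Matrix (Fin n) (Fin n) S) i j) = (U : Matrix (Fin n) (Fin n) S) i j :=
    fun i j => (Matrix.GeneralLinearGroup.ext_iff _ _).1 hU i j
  have hdetfix : τ ((U⁻¹).det : S) = ((U⁻¹).det : S) := by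
    have h3 : T U⁻¹ = U⁻¹ := by rw [map_inv, hU]
    have h4 : ((T U⁻¹).det : S) = τ ((U⁻¹).det : S) :=
      (RingHom.map_det (τ : S →+* S) ((U⁻¹ : Matrix.GeneralLinearGroup (Fin n) S) :
        Matrix (Fin n) (Fin n) S)).symm
    rw [← h4, h3]
  let W : Subalgebra R₁ S := Algebra.adjoin R₁ {s : S | τ s = s}
  have hfixW : ∀ s, τ s = s → s ∈ W := fun s hs => Algebra.subset_adjoin hs
  have hW : W.toSubring = ⊤ := by
    refine hgen _ ?_ ?_
    · rintro _ ⟨r, rfl⟩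
      exact W.algebraMap_mem r
    · have hle : Algebra.adjoin K (insert ((Z₂⁻¹ : Matrix.GeneralLinearGroup (Fin n) R₂).det : R₂)
          {z : R₂ | ∃ i j, z = (Z₂ : Matrix (Fin n) (Fin n) R₂) i j}) ≤
          (W.restrictScalars K).comap (IsScalarTower.toAlgHom K R₂ S) := by
        rw [Algebra.adjoin_le_iff]
        rintro z (rfl | ⟨i, j, rfl⟩)
        · change algebraMap R₂ S _ ∈ W
          have h5 : algebraMap R₂ S ((Z₂⁻¹).det : R₂) = ((Y₂⁻¹).det : S) :=
            RingHom.map_det (algebraMap R₂ S) _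
          have h6 : ((Y₁⁻¹).det : S) = algebraMap R₁ S ((Z₁⁻¹).det : R₁) :=
            (RingHom.map_det (algebraMap R₁ S) _).symm
          rw [h5, hYU, mul_inv_rev, map_mul, Units.val_mul, h6]
          exact W.mul_mem (hfixW _ hdetfix) (W.algebraMap_mem _)
        · change algebraMap R₂ S _ ∈ W
          have h5 : algebraMap R₂ S ((Z₂ : Matrix (Fin n) (Fin n) R₂) i j) =
              (Y₂ : Matrix (Fin n) (Fin n) S) i j := rfl
          rw [h5, hYU, Units.val_mul, Matrix.mul_apply]
          exact W.sum_mem fun k _ => W.mul_mem (W.algebraMap_mem _) (hfixW _ (hUfix k j))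
      rintro _ ⟨r, rfl⟩
      exact hle (hZ₂gen ▸ Algebra.mem_top)
  have hWtop : W = ⊤ := by
    rw [eq_top_iff]
    intro s _
    have : s ∈ W.toSubring := hW ▸ Subring.mem_top s
    exact this
  -- Constants are closed under products, so the algebra they generate over `R₁` is their span.
  have hspan := Algebra.adjoin_eq_span_of_subset R₁ (s := {s : S | τ s = s}) (by
    intro s hs
    refine Submodule.subset_span ?_
    induction hs using Submonoid.closure_induction with
    | mem x hx => exact hx
    | one => exact map_one τ
    | mul x y _ _ hx hy =>
      change τ (x * y) = x * y
      rw [map_mul, show τ x = x from hx, show τ y = y from hy])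
  rw [← hspan]
  change Subalgebra.toSubmodule W = ⊤
  rw [hWtop, Algebra.top_toSubmodule]

end IsPicardVessiotRing

/-- If a simple difference ring is generated by constants as a module over a simple difference
subring, then both have the same Krull dimension and the same rank of periodic elements. -/
theorem IsDifferenceSimple.ringKrullDim_eq_and_finrank_eq {K R S : Type*} [Field K] [CharZero K]
    [CommRing R] [CommRing S] [Algebra K R] [Algebra K S] [Algebra R S] [IsScalarTower K R S]
    [Algebra.FiniteType K S] {σ : R ≃+* R} {τ : S ≃+* S} (hσ : IsDifferenceSimple σ)
    (hτ : IsDifferenceSimple τ) (h : ∀ r, τ (algebraMap R S r) = algebraMap R S (σ r))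
    (hspan : Submodule.span R {s : S | τ s = s} = ⊤)
    [Module.Finite (fixedSubring σ) (periodicSubmodule σ)] :
    ringKrullDim S = ringKrullDim R ∧ Module.finrank (fixedSubring τ) (periodicSubmodule τ) =
      Module.finrank (fixedSubring σ) (periodicSubmodule σ) := by
  have := hτ.nontrivial
  have hinj : Function.Injective (algebraMap R S) := by
    rw [RingHom.injective_iff_ker_eq_bot]
    refine (hσ.eq_bot_or_eq_top _ fun a ha => ?_).resolve_right (RingHom.ker_ne_top _)
    rw [RingHom.mem_ker] at ha ⊢
    rw [← h, ha, map_zero]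
  refine ⟨?_, finrank_periodicSubmodule_eq_of_span_fixed hinj hσ h hspan⟩
  -- The spanning constants are algebraic over the field `K`, hence integral over `R`.
  have : Algebra.IsIntegral R S := by
    refine ⟨fun s => ?_⟩
    have hs : s ∈ Submodule.span R {s : S | τ s = s} := hspan ▸ Submodule.mem_top
    induction hs using Submodule.span_induction with
    | mem c hc => exact (hτ.isAlgebraic_of_fixed K hc).isIntegral.tower_top
    | zero => exact isIntegral_zero
    | add x y _ _ hx hy => exact hx.add hy
    | smul r x _ hx => exact hx.smul r
  exact ringKrullDim_eq_of_isIntegral_of_injective hinj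

theorem proposition4p9 {K : Type*} [Field K] [CharZero K] (σK : K ≃+* K)
    (hK : constantField σK = periodicField σK)
    {n : ℕ} (A : Matrix.GeneralLinearGroup (Fin n) K)
    (R₁ : Type*) [CommRing R₁] [Algebra K R₁] (σ₁ : R₁ ≃+* R₁)
    (h₁ : IsPicardVessiotRing σK A R₁ σ₁)
    (R₂ : Type*) [CommRing R₂] [Algebra K R₂] (σ₂ : R₂ ≃+* R₂)
    (h₂ : IsPicardVessiotRing σK A R₂ σ₂) :
    ringKrullDim R₁ = ringKrullDim R₂ ∧
      ∃ m : ℕ, HasMInvariant σK R₁ σ₁ m ∧ HasMInvariant σK R₂ σ₂ m := by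
  have := h₁.finiteType
  have := h₂.finiteType
  have := h₁.nontrivial
  have := h₂.nontrivial
  obtain ⟨hfin₁, hm₁⟩ := h₁.isDifferenceSimple.finite_periodicSubmodule_and_hasMInvariant
    h₁.map_algebraMap hK
  obtain ⟨hfin₂, hm₂⟩ := h₂.isDifferenceSimple.finite_periodicSubmodule_and_hasMInvariant
    h₂.map_algebraMap hK
  obtain ⟨S, _, _, _, _, τ, _, _, _, hτ, hτ₁, hτ₂, hgen⟩ :=
    exists_isDifferenceSimple_compositum h₁.map_algebraMap h₂.map_algebraMap
  obtain ⟨hdim₁, hrank₁⟩ := h₁.isDifferenceSimple.ringKrullDim_eq_and_finrank_eq (K := K) hτ hτ₁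
    (h₁.span_fixed_eq_top h₂ hτ₁ hτ₂ hgen)
  obtain ⟨hdim₂, hrank₂⟩ := h₂.isDifferenceSimple.ringKrullDim_eq_and_finrank_eq (K := K) hτ hτ₂
    (h₂.span_fixed_eq_top h₁ hτ₂ hτ₁ fun W h h' => hgen W h' h)
  refine ⟨hdim₁.symm.trans hdim₂, _, hm₁, ?_⟩
  rwa [← hrank₁, hrank₂]
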